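/- Let $p(z)=z^{\ell}+b_{\ell-1}z^{\ell-1}+\dots+b_1z+b_0$ be a polynomial with complex coefficients, $\ell\ge 3$; zeros are counted with multiplicity. Put $m=\lceil \ell/2\rceil$, $n=2m$. If $\ell$ is even let $a_j=b_j$ $(0\le j\le n-1)$; if $\ell$ is odd let $a_0=0$ and $a_j=b_{j-1}$ $(1\le j\le n-1)$. Define $$A_0=\begin{pmatrix}-a_0 & a_{n-1}a_0\\ -a_1 & a_{n-1}a_1-a_0\end{pmatrix},\qquad A_j=\begin{pmatrix}-a_{2j} & a_{n-1}a_{2j}-a_{2j-1}\\ -a_{2j+1} & a_{n-1}a_{2j+1}-a_{2j}\end{pmatrix}\quad(1\le j\le m-1).$$ Assume that $S\in\mathbb C^{2\times2}$ is nonsingular with $S^{-1}A_{m-1}S=\operatorname{diag}(\alpha,\beta)$, where $\alpha,\beta\in\mathbb C$ and $|\alpha|\le|\beta|$, and let $T_j=S^{-1}A_jS$. Let $\|\cdot\|$ be the matrix norm on $\mathbb C^{2\times 2}$ subordinate to (induced by) a vector norm on $\mathbb C^2$ that is absolute, i.e. depends only on the moduli of the coordinates (for example any $p$-norm, $1\le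 p\le\infty$). For $x>0$ let $$\tau(x)=\sum_{j=0}^{m-2}\frac{\|T_j\|}{x^{m-1-j}},\quad \Omega_1(x)=x^m-|\alpha|x^{m-1}+\sum_{j=0}^{m-2}\|T_j\|x^j,\quad \Omega_2(x)=x^m-|\beta|x^{m-1}+\sum_{j=0}^{m-2}\|T_j\|x^j ,$$ and let $\bar O(c;r)$ denote the closed disc with centre $c$ and radius $r$. If the positive solutions of $\Omega_1(x)=0$ are two numbers $x_1<x_2$, let $K_1=[x_1,x_2]$, otherwise $K_1=\emptyset$; if the positive solutions of $\Omega_2(x)=0$ are two numbers $y_1<y_2$, let $K_2=[y_1,y_2]$, otherwise $K_2=\emptyset$. Then the following holds. (a) If $K_1\ne\emptyset$, then $K_2\neq\emptyset$ and $K_1\subseteq K_2$. Exactly $\ell-2$ zeros of $p$ lie in $\bar O(0;\sqrt{x_1})$, while the squares of the two remaining zeros, and of no other zeros, lie in $\bar O(\alpha;\tau(x_2))\cup\bar O(\beta;\tau(x_2))$; in particular $p$ has no zero $z$ with $\sqrt{x_1}<|z|<(|\alpha|-\tau(x_2))^{1/2}$. If, in addition, $|\alpha-\beta|>2\tau(x_2)$,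 then each of the discs $\bar O(\alpha;\tau(x_2))$ and $\bar O(\beta;\tau(x_2))$ contains the square of exactly one zero of $p$. (b) If $K_1=\emptyset$, $K_2\ne\emptyset$ and $|\alpha-\beta|>2\tau(y_2)$, then the square of exactly one zero of $p$ lies in $\bar O(\beta;\tau(y_2))$, and the squares of the remaining $\ell-1$ zeros lie in $\bar O(0;y_2)\cup\bar O(\alpha;\tau(y_2))$. -/

import Mathlib

open Polynomial

noncomputable section

namespace SquaredCompanion

/-- `m = ⌈ℓ / 2⌉`, where `ℓ` is the degree of `p`. -/
def halfDeg (p : ℂ[X]) : ℕ := (p.natDegree + 1) / 2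

/-- The numbers `a_j`: the coefficients of `p` if `deg p` is even, those of `z p(z)` if `deg p` is
odd. -/
def coeffA (p : ℂ[X]) (j : ℕ) : ℂ :=
  if Even p.natDegree then p.coeff j else if j = 0 then 0 else p.coeff (j - 1)

/-- The `2 × 2` matrices `A_j`, with `n = 2m`. They are the blocks of the last block column of the
square of the companion matrix. -/
def blockA (p : ℂ[X]) (j : ℕ) : Matrix (Fin 2) (Fin 2) ℂ :=
  if j = 0 then
    !![-coeffA p 0, coeffA p (2 * halfDeg p - 1) * coeffA p 0;
       -coeffA p 1, coeffA p (2 * halfDeg p - 1) * coeffA p 1 - coeffA p 0]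
  else
    !![-coeffA p (2 * j),
        coeffA p (2 * halfDeg p - 1) * coeffA p (2 * j) - coeffA p (2 * j - 1);
       -coeffA p (2 * j + 1),
        coeffA p (2 * halfDeg p - 1) * coeffA p (2 * j + 1) - coeffA p (2 * j)]

/-- `T_j = S⁻¹ A_j S`. -/
def blockT (p : ℂ[X]) (S : Matrix (Fin 2) (Fin 2) ℂ) (j : ℕ) : Matrix (Fin 2) (Fin 2) ℂ :=
  S⁻¹ * blockA p j * S

/-- `N` is a norm on `ℂ²` that is absolute: it depends only on the moduli of the coordinates. -/
structure IsAbsoluteNorm (N : Seminorm ℂ (Fin 2 → ℂ)) : Prop where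
  eq_zero_of_map_eq_zero : ∀ v, N v = 0 → v = 0
  absolute : ∀ v w : Fin 2 → ℂ, (∀ i, ‖v i‖ = ‖w i‖) → N v = N w

/-- The matrix norm subordinate to (induced by) the vector norm `N`. -/
def subNorm (N : Seminorm ℂ (Fin 2 → ℂ)) (T : Matrix (Fin 2) (Fin 2) ℂ) : ℝ :=
  sSup {r : ℝ | ∃ v : Fin 2 → ℂ, N v = 1 ∧ N (T.mulVec v) = r}

/-- `τ(x) = ‖T_{m-2}‖ / x + ‖T_{m-3}‖ / x² + ⋯ + ‖T_0‖ / x^{m-1}`. -/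
def tau (p : ℂ[X]) (S : Matrix (Fin 2) (Fin 2) ℂ) (N : Seminorm ℂ (Fin 2 → ℂ)) (x : ℝ) : ℝ :=
  ∑ j ∈ Finset.range (halfDeg p - 1), subNorm N (blockT p S j) / x ^ (halfDeg p - 1 - j)

/-- `x^m - |γ| x^{m-1} + ‖T_{m-2}‖ x^{m-2} + ⋯ + ‖T_1‖ x + ‖T_0‖`; this is `Ω₁` for `γ = α` and
`Ω₂` for `γ = β`. -/
def Omega (p : ℂ[X]) (S : Matrix (Fin 2) (Fin 2) ℂ) (N : Seminorm ℂ (Fin 2 → ℂ)) (γ : ℂ)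
    (x : ℝ) : ℝ :=
  x ^ halfDeg p - ‖γ‖ * x ^ (halfDeg p - 1)
    + ∑ j ∈ Finset.range (halfDeg p - 1), subNorm N (blockT p S j) * x ^ j

/-- The positive solutions of `f(x) = 0` are `a` and `b`, with `a < b`. -/
def IsPosRootPair (f : ℝ → ℝ) (a b : ℝ) : Prop :=
  a < b ∧ {x : ℝ | 0 < x ∧ f x = 0} = {a, b}

/-- The interval `[a, b]` if `f(x) = 0` has the positive solutions `a < b`, and `∅` otherwise. -/
def rootInterval (f : ℝ → ℝ) : Set ℝ :=
  {x : ℝ | ∃ a b : ℝ, IsPosRootPair f a b ∧ x ∈ Set.Icc a b}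

open Classical in
/-- The number of zeros of `p` in `D`, counted with multiplicity. -/
def zeroCount (p : ℂ[X]) (D : Set ℂ) : ℕ :=
  (p.roots.filter (fun z => z ∈ D)).card

open Classical in
/-- The number of zeros of `p` whose squares lie in `D`, counted with multiplicity. -/
def sqZeroCount (p : ℂ[X]) (D : Set ℂ) : ℕ :=
  (p.roots.filter (fun z => z ^ 2 ∈ D)).card

end SquaredCompanion

end

/-! Let `q` be `p` or `z p`, whichever has even degree `2m`, and put `k = m - 1`. Then `q(z) q(-z) =
det(w^m - ∑ A_j w^j)` with `w = z²`, so the zeros of this determinant in `w` are the squares of the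
zeros of `q`. Conjugation by `S` turns the leading block into `diag(α, β)`. Scaling the other blocks
by `t ∈ [0, 1]` gives a family (`pencilDet`) whose zeros at `t = 0` are `0` (`2k` times), `α` and
`β`.

A null vector at a zero `w ≠ 0` satisfies `(w - diag(α, β)) v = t w^{-k} ∑ w^j T_j v`. Absolute
norms are monotone, so `|w - α| ≤ τ(|w|)` or `|w - β| ≤ τ(|w|)`, for every `t`. Between the two
positive roots of `Ω₁` one has `τ(x) < |α| - x`, which rules out both: no zero ever enters the
annulus `x₁ < |w| < x₂`. By the argument principle the `2k` zeros starting at `0` stay inside it.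
The other two have `|w| ≥ x₂`, and `τ` decreases, so they lie in the two discs. When the discs are
disjoint, the same homotopy on a slightly larger circle counts one zero in each.

The intervals are nested because `Ω(x) / x^k = x - |γ| + τ(x)` is convex and decreases as `|γ|`
grows. -/

noncomputable section
namespace SquaredCompanion

/-! ### Argument principle for polynomials on a circle -/

open Metric Real in
lemma circleIntegral_sub_inv_eq_ite {c a : ℂ} {r : ℝ} (hr : 0 < r) (ha : a ∉ sphere c r)
    [Decidable (a ∈ ball c r)] :
    (∮ z in C(c, r), (z - a)⁻¹) = if a ∈ ball c r then 2 * π * Complex.I else 0 := by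
  split_ifs with h
  · exact circleIntegral.integral_sub_inv_of_mem_ball h
  · have hout : a ∉ closedBall c r := by
      intro h'
      rw [← ball_union_sphere] at h'
      exact h'.elim h ha
    have hne : ∀ z ∈ closedBall c r, z - a ≠ 0 := fun z hz h0 =>
      hout (sub_eq_zero.1 h0 ▸ hz)
    refine Complex.circleIntegral_eq_zero_of_differentiable_on_off_countable hr.le
      Set.countable_empty ?_ ?_
    · exact ContinuousOn.inv₀ (by fun_prop) hne
    · intro z hz
      exact DifferentiableAt.inv (by fun_prop) (hne z (ball_subset_closedBall hz.1))

open Metric Real in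
open Classical in
lemma circleIntegral_sum_sub_inv {c : ℂ} {r : ℝ} (hr : 0 < r) (s : Multiset ℂ)
    (hs : ∀ a ∈ s, a ∉ sphere c r) :
    CircleIntegrable (fun z => (s.map fun a => (z - a)⁻¹).sum) c r ∧
    (∮ z in C(c, r), (s.map fun a => (z - a)⁻¹).sum) =
      2 * π * Complex.I * (s.filter (· ∈ ball c r)).card := by
  induction s using Multiset.induction_on with
  | empty => simp [circleIntegral]
  | cons a s ih =>
    obtain ⟨h1, h2⟩ := ih fun b hb => hs b (Multiset.mem_cons_of_mem hb)
    have ha : a ∉ sphere c r := hs a (Multiset.mem_cons_self a s)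
    have hint : CircleIntegrable (fun z => (z - a)⁻¹) c r := by
      refine ContinuousOn.circleIntegrable hr.le (ContinuousOn.inv₀ (by fun_prop) ?_)
      intro z hz h0
      exact ha (sub_eq_zero.1 h0 ▸ hz)
    simp only [Multiset.map_cons, Multiset.sum_cons]
    refine ⟨hint.add h1, ?_⟩
    rw [circleIntegral.integral_add hint h1, h2, circleIntegral_sub_inv_eq_ite hr ha,
      Multiset.filter_cons]
    split_ifs
    · simp only [Multiset.card_add, Multiset.card_singleton]
      push_cast
      ring
    · simp

open Metric Real in
open Classical in
lemma circleIntegral_derivative_div_eq {c : ℂ} {r : ℝ} (hr : 0 < r) (P : ℂ[X])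
    (hP : ∀ z ∈ sphere c r, P.eval z ≠ 0) :
    (∮ z in C(c, r), P.derivative.eval z / P.eval z) =
      2 * π * Complex.I * (P.roots.filter (· ∈ ball c r)).card := by
  rw [← (circleIntegral_sum_sub_inv hr P.roots ?_).2]
  · refine circleIntegral.integral_congr hr.le fun z hz => ?_
    simp only [(IsAlgClosed.splits P).eval_derivative_div_eval_of_ne_zero (hP z hz), one_div]
  · intro a ha h
    exact hP a h (isRoot_of_mem_roots ha)

open Metric Real in
open Classical in
/-- The number of zeros in a disc is constant along a homotopy of polynomials without zeros on
the boundary circle. -/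
lemma card_roots_ball_eq_of_homotopy (P : unitInterval → ℂ[X])
    (hP : Continuous fun q : unitInterval × ℂ => (P q.1).eval q.2)
    (hP' : Continuous fun q : unitInterval × ℂ => (P q.1).derivative.eval q.2)
    {c : ℂ} {r : ℝ} (hr : 0 < r) (h0 : ∀ t, ∀ z ∈ sphere c r, (P t).eval z ≠ 0) :
    ((P 0).roots.filter (· ∈ ball c r)).card = ((P 1).roots.filter (· ∈ ball c r)).card := by
  have hcont : Continuous fun t => ∮ z in C(c, r), (P t).derivative.eval z / (P t).eval z := by
    refine intervalIntegral.continuous_parametric_intervalIntegral_of_continuous' ?_ _ _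
    have hc : Continuous fun q : unitInterval × ℝ => circleMap c r q.2 :=
      (continuous_circleMap c r).comp continuous_snd
    have hm : Continuous fun q : unitInterval × ℝ => (q.1, circleMap c r q.2) :=
      continuous_fst.prodMk hc
    have hd : Continuous fun q : unitInterval × ℝ => deriv (circleMap c r) q.2 := by
      simp only [deriv_circleMap]
      exact ((continuous_circleMap 0 r).comp continuous_snd).mul continuous_const
    exact hd.smul ((hP'.comp hm).div (hP.comp hm)
      fun q => h0 _ _ (circleMap_mem_sphere c hr.le q.2))
  simp only [fun t => circleIntegral_derivative_div_eq hr (P t) (h0 t)] at hcont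
  -- The integral is `2πi` times the count; a continuous integer-valued function on the connected
  -- interval is constant.
  have hreal : Continuous fun t => (((P t).roots.filter (· ∈ ball c r)).card : ℝ) := by
    have := Complex.continuous_re.comp (hcont.const_smul (2 * π * Complex.I)⁻¹)
    refine this.congr fun t => ?_
    simp only [Function.comp, Pi.smul_apply, smul_eq_mul]
    rw [inv_mul_cancel_left₀ Complex.two_pi_I_ne_zero, Complex.natCast_re]
  have hnat : Continuous fun t => ((P t).roots.filter (· ∈ ball c r)).card :=
    Nat.isClosedEmbedding_coe_real.isEmbedding.continuous_iff.2 hreal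
  exact PreconnectedSpace.constant inferInstance hnat

/-! ### Absolute norms on `ℂ²` and the induced matrix norm -/

namespace IsAbsoluteNorm

variable {N : Seminorm ℂ (Fin 2 → ℂ)}

/-- `(s a, b)` is a convex combination of `(a, b)` and `(-a, b)`, which have equal norm. -/
lemma map_smul_fst_le (hN : IsAbsoluteNorm N) {s : ℝ} (hs : 0 ≤ s) (hs' : s ≤ 1) (a b : ℂ) :
    N ![s * a, b] ≤ N ![a, b] := by
  have h1 : N ![-a, b] = N ![a, b] := hN.absolute _ _ fun i => by fin_cases i <;> simp
  have h2 : (![s * a, b] : Fin 2 → ℂ) =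
      (((1 + s) / 2 : ℝ) : ℂ) • ![a, b] + (((1 - s) / 2 : ℝ) : ℂ) • ![-a, b] := by
    ext i
    fin_cases i <;> simp <;> ring
  rw [h2]
  refine (map_add_le_add N _ _).trans ?_
  rw [map_smul_eq_mul, map_smul_eq_mul, h1, Complex.norm_of_nonneg (by linarith),
    Complex.norm_of_nonneg (by linarith)]
  linarith

lemma map_smul_snd_le (hN : IsAbsoluteNorm N) {s : ℝ} (hs : 0 ≤ s) (hs' : s ≤ 1) (a b : ℂ) :
    N ![a, s * b] ≤ N ![a, b] := by
  have h1 : N ![a, -b] = N ![a, b] := hN.absolute _ _ fun i => by fin_cases i <;> simp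
  have h2 : (![a, s * b] : Fin 2 → ℂ) =
      (((1 + s) / 2 : ℝ) : ℂ) • ![a, b] + (((1 - s) / 2 : ℝ) : ℂ) • ![a, -b] := by
    ext i
    fin_cases i <;> simp <;> ring
  rw [h2]
  refine (map_add_le_add N _ _).trans ?_
  rw [map_smul_eq_mul, map_smul_eq_mul, h1, Complex.norm_of_nonneg (by linarith),
    Complex.norm_of_nonneg (by linarith)]
  linarith

lemma exists_scale {x y : ℂ} (h : ‖x‖ ≤ ‖y‖) : ∃ s : ℝ, 0 ≤ s ∧ s ≤ 1 ∧ ‖x‖ = ‖(s : ℂ) * y‖ := by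
  rcases eq_or_ne y 0 with rfl | hy
  · exact ⟨0, le_rfl, zero_le_one, by simpa using h⟩
  · have hy' : 0 < ‖y‖ := norm_pos_iff.2 hy
    refine ⟨‖x‖ / ‖y‖, by positivity, div_le_one_of_le₀ h hy'.le, ?_⟩
    rw [norm_mul, Complex.norm_of_nonneg (by positivity)]
    field_simp

/-- An absolute norm is monotone. -/
lemma mono (hN : IsAbsoluteNorm N) {u v : Fin 2 → ℂ} (h : ∀ i, ‖u i‖ ≤ ‖v i‖) : N u ≤ N v := by
  obtain ⟨s, hs, hs', es⟩ := exists_scale (h 0)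
  obtain ⟨t, ht, ht', et⟩ := exists_scale (h 1)
  calc N u = N ![s * v 0, t * v 1] := hN.absolute _ _ fun i => by
        fin_cases i
        · exact es
        · exact et
    _ ≤ N ![v 0, t * v 1] := hN.map_smul_fst_le hs hs' _ _
    _ ≤ N ![v 0, v 1] := hN.map_smul_snd_le ht ht' _ _
    _ = N v := by congr 1; ext i; fin_cases i <;> rfl

lemma pos (hN : IsAbsoluteNorm N) {v : Fin 2 → ℂ} (hv : v ≠ 0) : 0 < N v :=
  (apply_nonneg N v).lt_of_ne fun h => hv (hN.eq_zero_of_map_eq_zero v h.symm)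

/-- Needed because `sSup` of an unbounded set of reals is `0`. Monotonicity bounds each coordinate
of a unit vector by `1 / N(e_i)`. -/
lemma bddAbove_mulVec (hN : IsAbsoluteNorm N) (T : Matrix (Fin 2) (Fin 2) ℂ) :
    BddAbove {r : ℝ | ∃ v : Fin 2 → ℂ, N v = 1 ∧ N (T.mulVec v) = r} := by
  have key : ∀ (i : Fin 2) (v : Fin 2 → ℂ), N v = 1 → ‖v i‖ ≤ 1 / N (Pi.single i 1) := by
    intro i v hv
    have h := hN.mono (u := v i • Pi.single i 1) (v := v) fun j => by
      rcases eq_or_ne j i with rfl | hj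
      · simp
      · simp [hj]
    rw [map_smul_eq_mul, hv] at h
    rwa [le_div_iff₀ (hN.pos (by simp))]
  refine ⟨1 / N (Pi.single 0 1) * N (T.mulVec (Pi.single 0 1)) +
    1 / N (Pi.single 1 1) * N (T.mulVec (Pi.single 1 1)), ?_⟩
  rintro r ⟨v, hv, rfl⟩
  have hv' : v = v 0 • Pi.single 0 1 + v 1 • Pi.single 1 1 := by
    ext i
    fin_cases i <;> simp
  have : T.mulVec v = v 0 • T.mulVec (Pi.single 0 1) + v 1 • T.mulVec (Pi.single 1 1) := by
    conv_lhs => rw [hv']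
    rw [Matrix.mulVec_add, Matrix.mulVec_smul, Matrix.mulVec_smul]
  rw [this]
  refine (map_add_le_add N _ _).trans ?_
  rw [map_smul_eq_mul, map_smul_eq_mul]
  exact add_le_add (mul_le_mul_of_nonneg_right (key 0 v hv) (apply_nonneg _ _))
    (mul_le_mul_of_nonneg_right (key 1 v hv) (apply_nonneg _ _))

lemma map_mulVec_le (hN : IsAbsoluteNorm N) (T : Matrix (Fin 2) (Fin 2) ℂ) (v : Fin 2 → ℂ) :
    N (T.mulVec v) ≤ subNorm N T * N v := by
  rcases eq_or_ne v 0 with rfl | hv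
  · simp
  have hpos := hN.pos hv
  have h := le_csSup (hN.bddAbove_mulVec T)
    ⟨((N v)⁻¹ : ℂ) • v, by
      rw [map_smul_eq_mul, norm_inv, Complex.norm_of_nonneg hpos.le, inv_mul_cancel₀ hpos.ne'],
      rfl⟩
  rw [Matrix.mulVec_smul, map_smul_eq_mul, norm_inv, Complex.norm_of_nonneg hpos.le] at h
  rwa [← div_le_iff₀ hpos, div_eq_inv_mul]

end IsAbsoluteNorm

lemma subNorm_nonneg (N : Seminorm ℂ (Fin 2 → ℂ)) (T : Matrix (Fin 2) (Fin 2) ℂ) :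
    0 ≤ subNorm N T :=
  Real.sSup_nonneg (by rintro r ⟨v, -, rfl⟩; exact apply_nonneg _ _)

/-- If `w - diag(α, β) - B` is singular, where `B` maps vectors of norm `1` to vectors of norm at
most `ρ`, then `w` is at distance at most `ρ` from `α` or from `β`. -/
lemma IsAbsoluteNorm.norm_sub_le_or_of_mulVec_eq {N : Seminorm ℂ (Fin 2 → ℂ)}
    (hN : IsAbsoluteNorm N) {v u : Fin 2 → ℂ} (hv : v ≠ 0) {w α β : ℂ} {ρ : ℝ}
    (h0 : (w - α) * v 0 = u 0) (h1 : (w - β) * v 1 = u 1) (hu : N u ≤ ρ * N v) :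
    ‖w - α‖ ≤ ρ ∨ ‖w - β‖ ≤ ρ := by
  by_contra! hcon
  obtain ⟨h2, h3⟩ := hcon
  -- Each `|u i|` is at least `min(|w - α|, |w - β|) |v i|`, so monotonicity compares the norms with
  -- this single factor.
  have hmono := hN.mono (u := ((min ‖w - α‖ ‖w - β‖ : ℝ) : ℂ) • v) (v := u) fun i => by
    fin_cases i
    · simp only [Fin.zero_eta, Pi.smul_apply, smul_eq_mul, norm_mul, ← h0]
      rw [Complex.norm_of_nonneg (by positivity)]
      gcongr
      exact min_le_left _ _
    · simp only [Fin.mk_one, Pi.smul_apply, smul_eq_mul, norm_mul, ← h1]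
      rw [Complex.norm_of_nonneg (by positivity)]
      gcongr
      exact min_le_right _ _
  rw [map_smul_eq_mul, Complex.norm_of_nonneg (by positivity)] at hmono
  have := lt_min h2 h3
  have := hN.pos hv
  nlinarith

/-! ### The function `τ` and convexity on the positive half-line -/

/-- `c_{k-1} / x + c_{k-2} / x² + ⋯ + c_0 / x^k`. -/
def inversePowerSum (c : ℕ → ℝ) (k : ℕ) (x : ℝ) : ℝ :=
  ∑ j ∈ Finset.range k, c j / x ^ (k - j)

section InversePowerSum

variable {c : ℕ → ℝ} {k : ℕ}

lemma inversePowerSum_nonneg (hc : ∀ j, 0 ≤ c j) {x : ℝ} (hx : 0 < x) :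
    0 ≤ inversePowerSum c k x :=
  Finset.sum_nonneg fun j _ => div_nonneg (hc j) (by positivity)

lemma inversePowerSum_anti (hc : ∀ j, 0 ≤ c j) {x y : ℝ} (hx : 0 < x) (hxy : x ≤ y) :
    inversePowerSum c k y ≤ inversePowerSum c k x :=
  Finset.sum_le_sum fun j _ =>
    div_le_div_of_nonneg_left (hc j) (by positivity) (by gcongr)

/-- Every exponent `k - j` is at least `1`, so `x τ(x)` is nonincreasing. This supplies the blow-up
of `τ` at `0`. -/
lemma inversePowerSum_mul_div_le (hc : ∀ j, 0 ≤ c j) {x y : ℝ} (hx : 0 < x) (hxy : x ≤ y) :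
    inversePowerSum c k y * (y / x) ≤ inversePowerSum c k x := by
  have hy : 0 < y := hx.trans_le hxy
  rw [inversePowerSum, Finset.sum_mul]
  refine Finset.sum_le_sum fun j hj => ?_
  obtain ⟨i, hi⟩ : ∃ i, k - j = i + 1 :=
    ⟨k - j - 1, by have := Finset.mem_range.1 hj; omega⟩
  rw [hi]
  calc c j / y ^ (i + 1) * (y / x) = c j / (y ^ i * x) := by
        rw [pow_succ]
        field_simp
    _ ≤ c j / (x ^ i * x) :=
      div_le_div_of_nonneg_left (hc j) (by positivity) (by gcongr)
    _ = c j / x ^ (i + 1) := by rw [pow_succ]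

lemma convexOn_inversePowerSum (hc : ∀ j, 0 ≤ c j) :
    ConvexOn ℝ (Set.Ioi 0) (inversePowerSum c k) := by
  have h : ∀ s : Finset ℕ,
      ConvexOn ℝ (Set.Ioi 0) fun x : ℝ => ∑ j ∈ s, c j / x ^ (k - j) := by
    intro s
    induction s using Finset.induction_on with
    | empty => simpa using convexOn_const (0 : ℝ) (convex_Ioi 0)
    | insert j s hj ih =>
      simp only [Finset.sum_insert hj]
      refine ConvexOn.add ?_ ih
      refine ((convexOn_zpow (𝕜 := ℝ) (-((k - j : ℕ) : ℤ))).smul (hc j)).congr fun x _ => ?_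
      simp [div_eq_mul_inv]
  exact h _

lemma continuousOn_inversePowerSum : ContinuousOn (inversePowerSum c k) (Set.Ioi 0) := by
  unfold inversePowerSum
  refine continuousOn_finsetSum _ fun j _ => ?_
  exact continuousOn_const.div (by fun_prop) fun x hx => pow_ne_zero _ (ne_of_gt hx)

lemma pow_mul_inversePowerSum {x : ℝ} (hx : 0 < x) :
    x ^ k * inversePowerSum c k x = ∑ j ∈ Finset.range k, c j * x ^ j := by
  rw [inversePowerSum, Finset.mul_sum]
  refine Finset.sum_congr rfl fun j hj => ?_
  rw [← pow_sub_mul_pow x (Finset.mem_range.1 hj).le]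
  field_simp

end InversePowerSum

namespace IsPosRootPair

variable {f g : ℝ → ℝ} {a b : ℝ}

lemma congr (h : IsPosRootPair f a b) (hfg : ∀ x, 0 < x → (f x = 0 ↔ g x = 0)) :
    IsPosRootPair g a b :=
  ⟨h.1, by
    rw [← h.2]
    ext x
    exact ⟨fun hx => ⟨hx.1, (hfg x hx.1).2 hx.2⟩, fun hx => ⟨hx.1, (hfg x hx.1).1 hx.2⟩⟩⟩

lemma left_mem (h : IsPosRootPair f a b) : 0 < a ∧ f a = 0 := by
  have : a ∈ {x : ℝ | 0 < x ∧ f x = 0} := by rw [h.2]; simp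
  exact this

lemma right_mem (h : IsPosRootPair f a b) : 0 < b ∧ f b = 0 := by
  have : b ∈ {x : ℝ | 0 < x ∧ f x = 0} := by rw [h.2]; simp
  exact this

/-- Convexity gives `f x ≤ 0`; equality would produce a third positive zero. -/
lemma neg_of_mem_Ioo (h : IsPosRootPair f a b) (hf : ConvexOn ℝ (Set.Ioi 0) f) {x : ℝ}
    (hx : x ∈ Set.Ioo a b) : f x < 0 := by
  obtain ⟨ha, fa⟩ := h.left_mem
  obtain ⟨hb, fb⟩ := h.right_mem
  have hle := hf.le_max_of_mem_Icc (x := a) (y := b) (z := x) ha hb (Set.Ioo_subset_Icc_self hx)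
  rw [fa, fb, max_self] at hle
  refine hle.lt_of_ne fun h0 => ?_
  have : x ∈ {x : ℝ | 0 < x ∧ f x = 0} := ⟨ha.trans hx.1, h0⟩
  rw [h.2] at this
  rcases this with rfl | rfl
  · exact lt_irrefl _ hx.1
  · exact lt_irrefl _ hx.2

end IsPosRootPair

/-- If `x < y` were both zeros, the rise from `f d < 0` to `f x = 0` would by convexity force `f x <
f y`. -/
lemma eq_of_convexOn_of_neg_left {s : Set ℝ} {f : ℝ → ℝ} (hf : ConvexOn ℝ s f) {d x y : ℝ}
    (hd : d ∈ s) (hx : x ∈ s) (hy : y ∈ s) (fd : f d < 0) (fx : f x = 0) (fy : f y = 0)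
    (hdx : d < x) (hdy : d < y) : x = y := by
  have key : ∀ x y, y ∈ s → f x = 0 → f y = 0 → d < x → ¬ x < y := by
    intro x y hy fx fy hdx hxy
    have := hf.lt_right_of_left_lt hd hy (z := x)
      (by rw [openSegment_eq_Ioo (hdx.trans hxy)]; exact ⟨hdx, hxy⟩) (by rw [fx]; exact fd)
    linarith
  exact le_antisymm (not_lt.1 (key y x hx fy fx hdy)) (not_lt.1 (key x y hy fx fy hdx))

lemma eq_of_convexOn_of_neg_right {s : Set ℝ} {f : ℝ → ℝ} (hf : ConvexOn ℝ s f) {d x y : ℝ}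
    (hd : d ∈ s) (hx : x ∈ s) (hy : y ∈ s) (fd : f d < 0) (fx : f x = 0) (fy : f y = 0)
    (hdx : x < d) (hdy : y < d) : x = y := by
  have key : ∀ x y, x ∈ s → f x = 0 → f y = 0 → y < d → ¬ x < y := by
    intro x y hx fx fy hyd hxy
    have := hf.lt_left_of_right_lt hx hd (z := y)
      (by rw [openSegment_eq_Ioo (hxy.trans hyd)]; exact ⟨hxy, hyd⟩) (by rw [fy]; exact fd)
    linarith
  exact le_antisymm (not_lt.1 (key y x hy fy fx hdx)) (not_lt.1 (key x y hx fx fy hdy))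

/-- A convex function with a sign pattern `+, ≤ 0, < 0, ≤ 0, +` has exactly two positive zeros. -/
lemma exists_isPosRootPair {f : ℝ → ℝ} (hf : ConvexOn ℝ (Set.Ioi 0) f)
    (hc : ContinuousOn f (Set.Ioi 0)) {a x d y b : ℝ} (ha : 0 < a) (hax : a ≤ x) (hxd : x < d)
    (hdy : d < y) (hyb : y ≤ b) (fa : 0 ≤ f a) (fx : f x ≤ 0) (fd : f d < 0) (fy : f y ≤ 0)
    (fb : 0 ≤ f b) : ∃ u v, u ≤ x ∧ y ≤ v ∧ IsPosRootPair f u v := by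
  obtain ⟨u, hu, fu⟩ := intermediate_value_Icc' hax
    (hc.mono fun z hz => ha.trans_le hz.1) ⟨fx, fa⟩
  obtain ⟨v, hv, fv⟩ := intermediate_value_Icc hyb
    (hc.mono fun z hz => (ha.trans_le (hax.trans (hxd.le.trans hdy.le))).trans_le hz.1) ⟨fy, fb⟩
  have hu0 : 0 < u := ha.trans_le hu.1
  have hud : u < d := hu.2.trans_lt hxd
  have hdv : d < v := hdy.trans_le hv.1
  refine ⟨u, v, hu.2, hv.1, hud.trans hdv, ?_⟩
  ext z
  simp only [Set.mem_ofPred_eq, Set.mem_insert_iff, Set.mem_singleton_iff]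
  constructor
  · rintro ⟨hz, fz⟩
    rcases lt_trichotomy z d with h | rfl | h
    · exact Or.inl (eq_of_convexOn_of_neg_right hf (hu0.trans hud) hz hu0 fd fz fu h hud)
    · exact absurd fz fd.ne
    · exact Or.inr (eq_of_convexOn_of_neg_left hf (hu0.trans hud) hz
        (hu0.trans (hud.trans hdv)) fd fz fv h hdv)
  · rintro (rfl | rfl)
    · exact ⟨hu0, fu⟩
    · exact ⟨hu0.trans (hud.trans hdv), fv⟩

/-- The function `x ↦ x - γ + τ(x)`. -/
def radialGap (c : ℕ → ℝ) (k : ℕ) (γ x : ℝ) : ℝ := x - γ + inversePowerSum c k x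

section RadialGap

variable {c : ℕ → ℝ} {k : ℕ}

lemma convexOn_radialGap (hc : ∀ j, 0 ≤ c j) (γ : ℝ) :
    ConvexOn ℝ (Set.Ioi 0) (radialGap c k γ) :=
  ((convexOn_id (convex_Ioi (0 : ℝ))).sub (concaveOn_const γ (convex_Ioi 0))).add
    (convexOn_inversePowerSum hc)

lemma continuousOn_radialGap (γ : ℝ) : ContinuousOn (radialGap c k γ) (Set.Ioi 0) :=
  (continuousOn_id.sub continuousOn_const).add continuousOn_inversePowerSum

lemma mul_radialGap (γ : ℝ) {x : ℝ} (hx : 0 < x) :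
    x ^ k * radialGap c k γ x =
      x ^ (k + 1) - γ * x ^ k + ∑ j ∈ Finset.range k, c j * x ^ j := by
  rw [radialGap, mul_add, pow_mul_inversePowerSum hx]
  ring

/-- If `x ↦ x - γ + τ(x)` has two positive zeros, so has `x ↦ x - δ + τ(x)` for `γ ≤ δ`, and they
enclose the former. -/
lemma exists_isPosRootPair_radialGap (hc : ∀ j, 0 ≤ c j) {γ δ : ℝ} (hγδ : γ ≤ δ) {x₁ x₂ : ℝ}
    (h : IsPosRootPair (radialGap c k γ) x₁ x₂) :
    ∃ y₁ y₂, y₁ ≤ x₁ ∧ x₂ ≤ y₂ ∧ IsPosRootPair (radialGap c k δ) y₁ y₂ := by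
  obtain ⟨h1, f1⟩ := h.left_mem
  obtain ⟨h2, f2⟩ := h.right_mem
  have hle : ∀ x, radialGap c k δ x ≤ radialGap c k γ x := fun x => by
    unfold radialGap; linarith
  have hmid : (x₁ + x₂) / 2 ∈ Set.Ioo x₁ x₂ := ⟨by linarith [h.1], by linarith [h.1]⟩
  have hδ : 0 ≤ δ := by
    have := inversePowerSum_nonneg (k := k) hc h1
    unfold radialGap at f1
    linarith
  -- Both gaps vanish, so `τ(x₁) = x₂ - x₁ + τ(x₂)`.
  have ht : 0 < inversePowerSum c k x₁ := by
    have := inversePowerSum_nonneg (k := k) hc h2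
    have := h.1
    unfold radialGap at f1 f2
    linarith
  set t := inversePowerSum c k x₁ with ht_def
  have hpos : 0 < x₁ * t / (δ + t) := by positivity
  have hle1 : x₁ * t / (δ + t) ≤ x₁ := by
    rw [div_le_iff₀ (by positivity)]
    nlinarith
  -- The left endpoint `a` is chosen so that `τ(a) ≥ t x₁ / a = δ + t`, which makes the gap
  -- nonnegative there.
  refine exists_isPosRootPair (convexOn_radialGap hc δ) (continuousOn_radialGap δ)
    (a := x₁ * t / (δ + t)) (b := max x₂ δ) hpos hle1 hmid.1 hmid.2 (le_max_left _ _) ?_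
    ((hle _).trans f1.le) ((hle _).trans_lt (h.neg_of_mem_Ioo (convexOn_radialGap hc γ) hmid))
    ((hle _).trans f2.le) ?_
  · have hs := inversePowerSum_mul_div_le (k := k) hc hpos hle1
    have : t * (x₁ / (x₁ * t / (δ + t))) = δ + t := by field_simp
    rw [← ht_def, this] at hs
    unfold radialGap
    linarith
  · have := inversePowerSum_nonneg (k := k) hc (h2.trans_le (le_max_left x₂ δ))
    have := le_max_right x₂ δ
    unfold radialGap
    linarith

end RadialGap

/-! ### The homotopy of determinants and the location of its zeros -/

/-- The entries of the matrix polynomial `∑_{j < k} T_j X^j`. -/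
def lowerEntry (k : ℕ) (T : ℕ → Matrix (Fin 2) (Fin 2) ℂ) (a b : Fin 2) : ℂ[X] :=
  ∑ j ∈ Finset.range k, C (T j a b) * X ^ j

/-- The determinant of `X^{k+1} - diag(α, β) X^k - t ∑_{j < k} T_j X^j`. -/
def pencilDet (k : ℕ) (α β : ℂ) (T : ℕ → Matrix (Fin 2) (Fin 2) ℂ) (t : ℂ) : ℂ[X] :=
  (X ^ k * (X - C α) - C t * lowerEntry k T 0 0) *
      (X ^ k * (X - C β) - C t * lowerEntry k T 1 1) -
    (C t * lowerEntry k T 0 1) * (C t * lowerEntry k T 1 0)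

section PencilDet

variable {k : ℕ} {α β : ℂ} {T : ℕ → Matrix (Fin 2) (Fin 2) ℂ}

lemma eval_lowerEntry (a b : Fin 2) (w : ℂ) :
    (lowerEntry k T a b).eval w = (∑ j ∈ Finset.range k, w ^ j • T j) a b := by
  rw [lowerEntry, eval_finsetSum, Matrix.sum_apply]
  refine Finset.sum_congr rfl fun j _ => ?_
  rw [eval_mul, eval_C, eval_pow, eval_X, Matrix.smul_apply, smul_eq_mul, mul_comm]

lemma eval_pencilDet (t w : ℂ) :
    (pencilDet k α β T t).eval w =
      (w ^ k • (w • (1 : Matrix (Fin 2) (Fin 2) ℂ) - !![α, 0; 0, β]) -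
        t • ∑ j ∈ Finset.range k, w ^ j • T j).det := by
  rw [Matrix.det_fin_two]
  simp only [pencilDet, eval_sub, eval_mul, eval_C, eval_pow, eval_X, eval_lowerEntry]
  simp

lemma map_sum_pow_smul_mulVec_le {N : Seminorm ℂ (Fin 2 → ℂ)} (hN : IsAbsoluteNorm N) (w : ℂ)
    (v : Fin 2 → ℂ) :
    N ((∑ j ∈ Finset.range k, w ^ j • T j).mulVec v) ≤
      (∑ j ∈ Finset.range k, subNorm N (T j) * ‖w‖ ^ j) * N v := by
  rw [Matrix.sum_mulVec, Finset.sum_mul]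
  refine (Finset.le_sum_of_subadditive N (map_zero N).le (map_add_le_add N) _ _).trans ?_
  refine Finset.sum_le_sum fun j _ => ?_
  rw [Matrix.smul_mulVec, map_smul_eq_mul, norm_pow]
  have := mul_le_mul_of_nonneg_left (hN.map_mulVec_le (T j) v) (pow_nonneg (norm_nonneg w) j)
  linarith

/-- Nonzero zeros of the perturbed determinants lie near `α` or near `β`. -/
lemma norm_sub_le_or_of_eval_pencilDet_eq_zero {N : Seminorm ℂ (Fin 2 → ℂ)}
    (hN : IsAbsoluteNorm N) {t w : ℂ} (ht : ‖t‖ ≤ 1) (hw : w ≠ 0)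
    (h : (pencilDet k α β T t).eval w = 0) :
    ‖w - α‖ ≤ inversePowerSum (fun j => subNorm N (T j)) k ‖w‖ ∨
      ‖w - β‖ ≤ inversePowerSum (fun j => subNorm N (T j)) k ‖w‖ := by
  rw [eval_pencilDet, ← Matrix.exists_mulVec_eq_zero_iff] at h
  obtain ⟨v, hv, hMv⟩ := h
  rw [Matrix.sub_mulVec, sub_eq_zero, Matrix.smul_mulVec, Matrix.smul_mulVec] at hMv
  set R := ∑ j ∈ Finset.range k, w ^ j • T j with hR
  have hwk : w ^ k ≠ 0 := pow_ne_zero _ hw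
  have hw' : 0 < ‖w‖ := norm_pos_iff.2 hw
  -- The null vector equation divided by `w ^ k`.
  have hu : (w • (1 : Matrix (Fin 2) (Fin 2) ℂ) - !![α, 0; 0, β]).mulVec v =
      ((w ^ k)⁻¹ * t) • R.mulVec v := by
    rw [mul_smul, ← hMv, inv_smul_smul₀ hwk]
  refine hN.norm_sub_le_or_of_mulVec_eq hv (u := ((w ^ k)⁻¹ * t) • R.mulVec v) ?_ ?_ ?_
  · rw [← hu]
    simp [Matrix.mulVec, dotProduct]
  · rw [← hu]
    simp [Matrix.mulVec, dotProduct]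
  · have hS := map_sum_pow_smul_mulVec_le (k := k) (T := T) hN w v
    rw [← pow_mul_inversePowerSum hw'] at hS
    rw [map_smul_eq_mul, norm_mul, norm_inv, norm_pow]
    have hpk : 0 < ‖w‖ ^ k := by positivity
    calc (‖w‖ ^ k)⁻¹ * ‖t‖ * N (R.mulVec v)
        ≤ (‖w‖ ^ k)⁻¹ * 1 * (‖w‖ ^ k * inversePowerSum (fun j => subNorm N (T j)) k ‖w‖ * N v) := by
          gcongr
      _ = inversePowerSum (fun j => subNorm N (T j)) k ‖w‖ * N v := by
          field_simp

lemma roots_pencilDet_zero :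
    (pencilDet k α β T 0).roots = Multiset.replicate (2 * k) 0 + {α} + {β} := by
  have h : pencilDet k α β T 0 = X ^ (2 * k) * (X - C α) * (X - C β) := by
    simp only [pencilDet, C_0]
    ring
  have h1 : (X ^ (2 * k) * (X - C α) : ℂ[X]) ≠ 0 :=
    mul_ne_zero (pow_ne_zero _ X_ne_zero) (X_sub_C_ne_zero α)
  rw [h, roots_mul (mul_ne_zero h1 (X_sub_C_ne_zero β)), roots_mul h1, roots_X_sub_C,
    roots_X_sub_C, roots_X_pow, Multiset.nsmul_singleton]

open Metric in
open Classical in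
lemma card_roots_pencilDet_ball_eq {z : ℂ} {r : ℝ} (hr : 0 < r)
    (h0 : ∀ t : ℂ, ‖t‖ ≤ 1 → ∀ w ∈ sphere z r, (pencilDet k α β T t).eval w ≠ 0) :
    ((pencilDet k α β T 1).roots.filter (· ∈ ball z r)).card =
      ((Multiset.replicate (2 * k) 0 + {α} + {β}).filter (· ∈ ball z r)).card := by
  have h := card_roots_ball_eq_of_homotopy
    (fun t : unitInterval => pencilDet k α β T ((t : ℝ) : ℂ)) ?_ ?_ hr fun t w hw =>
      h0 _ (by rw [Complex.norm_of_nonneg t.2.1]; exact t.2.2) w hw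
  · simp only [Set.Icc.coe_one, Complex.ofReal_one, Set.Icc.coe_zero, Complex.ofReal_zero] at h
    rw [← h, roots_pencilDet_zero]
  · simp only [pencilDet, eval_sub, eval_mul, eval_C, eval_pow, eval_X]
    fun_prop
  · simp only [pencilDet, derivative_sub, derivative_mul, derivative_C, eval_add, eval_sub,
      eval_mul, eval_C, eval_pow, eval_X]
    fun_prop

end PencilDet

/-! ### Squares of the zeros as zeros of the determinant -/

lemma sum_range_two_mul {M : Type*} [AddCommMonoid M] (f : ℕ → M) (n : ℕ) :
    ∑ i ∈ Finset.range (2 * n), f i = ∑ j ∈ Finset.range n, (f (2 * j) + f (2 * j + 1)) := by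
  induction n with
  | zero => simp
  | succ n ih =>
    rw [Finset.sum_range_succ, ← ih, Nat.mul_succ, Finset.sum_range_succ, Finset.sum_range_succ,
      add_assoc]

/-- `p` if `deg p` is even, `X p` if `deg p` is odd. -/
def padded (p : ℂ[X]) : ℂ[X] := if Even p.natDegree then p else X * p

/-- The multiplicity of the additional zero of `padded p` at the origin. -/
def padding (p : ℂ[X]) : ℕ := if Even p.natDegree then 0 else 1

section Padded

variable {p : ℂ[X]} {k : ℕ}

lemma monic_padded (hp : p.Monic) : (padded p).Monic := by
  unfold padded
  split_ifs
  · exact hp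
  · exact monic_X.mul hp

lemma roots_padded (hp : p.Monic) :
    (padded p).roots = p.roots + Multiset.replicate (padding p) 0 := by
  unfold padded padding
  split_ifs
  · simp
  · rw [roots_mul (mul_ne_zero X_ne_zero hp.ne_zero), roots_X, add_comm]
    rfl

lemma natDegree_add_padding (hk : halfDeg p = k + 1) :
    p.natDegree + padding p = 2 * (k + 1) := by
  unfold halfDeg at hk
  unfold padding
  split_ifs with h
  · obtain ⟨r, hr⟩ := h
    omega
  · obtain ⟨r, hr⟩ := Nat.not_even_iff_odd.1 h
    omega

lemma card_roots_padded (hp : p.Monic) (hk : halfDeg p = k + 1) :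
    Multiset.card (padded p).roots = 2 * (k + 1) := by
  rw [roots_padded hp, Multiset.card_add, Multiset.card_replicate,
    ← (IsAlgClosed.splits p).natDegree_eq_card_roots, natDegree_add_padding hk]

lemma eval_padded (hp : p.Monic) (hk : halfDeg p = k + 1) (z : ℂ) :
    (padded p).eval z =
      z ^ (2 * (k + 1)) + ∑ i ∈ Finset.range (2 * (k + 1)), coeffA p i * z ^ i := by
  have hdeg := natDegree_add_padding hk
  unfold padding at hdeg
  unfold padded
  split_ifs at hdeg ⊢ with h
  · rw [eval_eq_sum_range, Finset.sum_range_succ, hp.coeff_natDegree, one_mul, add_comm]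
    simp only [coeffA, if_pos h]
    rw [← hdeg, add_zero]
  · rw [eval_mul, eval_X, eval_eq_sum_range, Finset.sum_range_succ, hp.coeff_natDegree, one_mul,
      ← hdeg, Finset.sum_range_succ']
    simp only [coeffA, if_neg h]
    simp only [Nat.add_sub_cancel, if_true, zero_mul, Nat.add_eq_zero_iff, one_ne_zero, and_false,
      if_false, add_zero, mul_add, Finset.mul_sum]
    rw [add_comm, pow_succ']
    congr 1
    exact Finset.sum_congr rfl fun i _ => by ring

lemma blockA_apply_zero_zero (j : ℕ) : blockA p j 0 0 = -coeffA p (2 * j) := by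
  unfold blockA
  split_ifs with h
  · simp [h]
  · simp

lemma blockA_apply_one_zero (j : ℕ) : blockA p j 1 0 = -coeffA p (2 * j + 1) := by
  unfold blockA
  split_ifs with h
  · simp [h]
  · simp

lemma blockA_apply_one_one (j : ℕ) :
    blockA p j 1 1 =
      coeffA p (2 * halfDeg p - 1) * coeffA p (2 * j + 1) - coeffA p (2 * j) := by
  unfold blockA
  split_ifs with h
  · simp [h]
  · simp

lemma blockA_zero_apply_zero_one :
    blockA p 0 0 1 = coeffA p (2 * halfDeg p - 1) * coeffA p 0 := by
  simp [blockA]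

lemma blockA_succ_apply_zero_one (j : ℕ) :
    blockA p (j + 1) 0 1 =
      coeffA p (2 * halfDeg p - 1) * coeffA p (2 * (j + 1)) - coeffA p (2 * j + 1) := by
  simp [blockA, show 2 * (j + 1) - 1 = 2 * j + 1 by omega]

/-- `det (z^{2m} - ∑ A_j z^{2j}) = q(z) q(-z)`. -/
lemma det_blockA_pencil (hp : p.Monic) (hk : halfDeg p = k + 1) (z : ℂ) :
    ((z ^ 2) ^ (k + 1) • (1 : Matrix (Fin 2) (Fin 2) ℂ) -
        ∑ j ∈ Finset.range (k + 1), (z ^ 2) ^ j • blockA p j).det =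
      (padded p).eval z * (padded p).eval (-z) := by
  have hc : 2 * halfDeg p - 1 = 2 * k + 1 := by omega
  set w := z ^ 2 with hw
  -- `e` and `o` split `q` by parity: `q(±z) = w^m + e ± z o`, so the target is `(w^m + e)² - w o²`.
  set e := ∑ j ∈ Finset.range (k + 1), coeffA p (2 * j) * w ^ j with he
  set o := ∑ j ∈ Finset.range (k + 1), coeffA p (2 * j + 1) * w ^ j with ho
  have hq : ∀ y : ℂ, y ^ 2 = w → (padded p).eval y = w ^ (k + 1) + e + y * o := by
    intro y hy
    rw [eval_padded hp hk, sum_range_two_mul, Finset.sum_add_distrib, pow_mul, hy, ← add_assoc,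
      he, ho, Finset.mul_sum]
    congr 1
    · congr 1
      exact Finset.sum_congr rfl fun j _ => by rw [pow_mul, hy]
    · exact Finset.sum_congr rfl fun j _ => by rw [pow_succ, pow_mul, hy]; ring
  have h00 : (∑ j ∈ Finset.range (k + 1), w ^ j • blockA p j) 0 0 = -e := by
    simp only [Matrix.sum_apply, Matrix.smul_apply, blockA_apply_zero_zero, smul_eq_mul, he,
      ← Finset.sum_neg_distrib]
    exact Finset.sum_congr rfl fun j _ => by ring
  have h10 : (∑ j ∈ Finset.range (k + 1), w ^ j • blockA p j) 1 0 = -o := by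
    simp only [Matrix.sum_apply, Matrix.smul_apply, blockA_apply_one_zero, smul_eq_mul, ho,
      ← Finset.sum_neg_distrib]
    exact Finset.sum_congr rfl fun j _ => by ring
  have h11 : (∑ j ∈ Finset.range (k + 1), w ^ j • blockA p j) 1 1 =
      coeffA p (2 * k + 1) * o - e := by
    simp only [Matrix.sum_apply, Matrix.smul_apply, blockA_apply_one_one, smul_eq_mul, ho, he, hc,
      Finset.mul_sum, ← Finset.sum_sub_distrib]
    exact Finset.sum_congr rfl fun j _ => by ring
  -- The index shift `a_{2j-1}` turns `o` into `w o` without its top term. Restoring that term makes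
  -- the second column of the pencil `(w o, w^m + e)` minus `a_{n-1}` times the first column `(w^m +
  -- e, o)`, so `a_{n-1}` drops out of the determinant.
  have h01 : (∑ j ∈ Finset.range (k + 1), w ^ j • blockA p j) 0 1 =
      coeffA p (2 * k + 1) * e - w * (o - coeffA p (2 * k + 1) * w ^ k) := by
    rw [ho, Finset.sum_range_succ (fun j => coeffA p (2 * j + 1) * w ^ j) k, add_sub_cancel_right, he, Finset.sum_range_succ' _ k,
      Finset.sum_range_succ' _ k]
    simp only [Matrix.add_apply, Matrix.sum_apply, Matrix.smul_apply, blockA_zero_apply_zero_one,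
      blockA_succ_apply_zero_one, smul_eq_mul, hc, mul_add, Finset.mul_sum]
    rw [add_sub_right_comm, ← Finset.sum_sub_distrib]
    congr 1
    · exact Finset.sum_congr rfl fun j _ => by ring
    · ring
  rw [Matrix.det_fin_two, hq z rfl, hq (-z) (by rw [neg_sq])]
  simp only [Matrix.sub_apply, h00, h01, h10, h11, Matrix.smul_apply, smul_eq_mul,
    Matrix.one_apply_eq, Matrix.one_apply_ne (show (0 : Fin 2) ≠ 1 by decide),
    Matrix.one_apply_ne (show (1 : Fin 2) ≠ 0 by decide)]
  linear_combination (-(o ^ 2)) * hw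

variable {S : Matrix (Fin 2) (Fin 2) ℂ} {α β : ℂ}

lemma eval_pencilDet_blockT (hp : p.Monic) (hk : halfDeg p = k + 1) (hS : IsUnit S)
    (hdiag : S⁻¹ * blockA p k * S = !![α, 0; 0, β]) (z : ℂ) :
    (pencilDet k α β (blockT p S) 1).eval (z ^ 2) =
      (padded p).eval z * (padded p).eval (-z) := by
  have hdet : IsUnit S.det := (Matrix.isUnit_iff_isUnit_det S).1 hS
  rw [eval_pencilDet, ← det_blockA_pencil hp hk, ← hdiag,
    ← Matrix.det_conj' hS ((z ^ 2) ^ (k + 1) • (1 : Matrix (Fin 2) (Fin 2) ℂ) - _)]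
  congr 1
  simp only [blockT]
  rw [mul_sub, sub_mul, Finset.sum_range_succ, mul_add, add_mul, Finset.mul_sum, Finset.sum_mul]
  simp only [Matrix.mul_smul, Matrix.smul_mul, Matrix.mul_one, Matrix.nonsing_inv_mul S hdet,
    one_smul, smul_sub, smul_smul, pow_succ]
  abel

/-- The zeros of the unperturbed determinant are the squares of the zeros of `padded p`. -/
lemma roots_pencilDet_blockT (hp : p.Monic) (hk : halfDeg p = k + 1) (hS : IsUnit S)
    (hdiag : S⁻¹ * blockA p k * S = !![α, 0; 0, β]) :
    (pencilDet k α β (blockT p S) 1).roots = (padded p).roots.map (· ^ 2) := by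
  have hprod : ∀ z, (padded p).eval z = ((padded p).roots.map fun a => z - a).prod := by
    intro z
    conv_lhs => rw [(IsAlgClosed.splits (padded p)).eq_prod_roots_of_monic (monic_padded hp)]
    rw [eval_multiset_prod, Multiset.map_map]
    simp
  have hneg : ∀ z, (padded p).eval (-z) = ((padded p).roots.map fun a => z + a).prod := by
    intro z
    -- The number of roots of `padded p` is even, so the signs cancel.
    have : ∀ a, -z - a = (-1) * (z + a) := fun a => by ring
    simp only [hprod, this]
    rw [Multiset.prod_map_mul, Multiset.map_const', Multiset.prod_replicate,
      card_roots_padded hp hk, pow_mul]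
    simp
  have h : pencilDet k α β (blockT p S) 1 =
      (((padded p).roots.map (· ^ 2)).map fun a => X - C a).prod := by
    refine Polynomial.funext fun w => ?_
    obtain ⟨z, rfl⟩ := IsAlgClosed.exists_pow_nat_eq w (n := 2) two_pos
    rw [eval_pencilDet_blockT hp hk hS hdiag, hprod, hneg, ← Multiset.prod_map_mul,
      eval_multiset_prod, Multiset.map_map, Multiset.map_map]
    congr 1
    refine Multiset.map_congr rfl fun a _ => ?_
    simp only [Function.comp, eval_sub, eval_X, eval_C]
    ring
  rw [h, roots_multiset_prod_X_sub_C]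

lemma roots_pencilDet_blockT_eq_add (hp : p.Monic) (hk : halfDeg p = k + 1) (hS : IsUnit S)
    (hdiag : S⁻¹ * blockA p k * S = !![α, 0; 0, β]) :
    (pencilDet k α β (blockT p S) 1).roots =
      p.roots.map (· ^ 2) + Multiset.replicate (padding p) 0 := by
  rw [roots_pencilDet_blockT hp hk hS hdiag, roots_padded hp, Multiset.map_add,
    Multiset.map_replicate]
  simp

lemma sq_mem_roots_pencilDet (hp : p.Monic) (hk : halfDeg p = k + 1) (hS : IsUnit S)
    (hdiag : S⁻¹ * blockA p k * S = !![α, 0; 0, β]) {z : ℂ} (hz : p.IsRoot z) :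
    z ^ 2 ∈ (pencilDet k α β (blockT p S) 1).roots := by
  rw [roots_pencilDet_blockT_eq_add hp hk hS hdiag]
  exact Multiset.mem_add.2 (Or.inl (Multiset.mem_map_of_mem _
    ((mem_roots hp.ne_zero).2 hz)))

open Classical in
lemma card_filter_map_sq (D : Set ℂ) :
    ((p.roots.map (· ^ 2)).filter (· ∈ D)).card = sqZeroCount p D := by
  rw [Multiset.filter_map, Multiset.card_map]
  rfl

open Classical in
lemma card_filter_roots_pencilDet_of_notMem (hp : p.Monic) (hk : halfDeg p = k + 1)
    (hS : IsUnit S) (hdiag : S⁻¹ * blockA p k * S = !![α, 0; 0, β]) {D : Set ℂ} (hD : 0 ∉ D) :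
    ((pencilDet k α β (blockT p S) 1).roots.filter (· ∈ D)).card = sqZeroCount p D := by
  rw [roots_pencilDet_blockT_eq_add hp hk hS hdiag, Multiset.filter_add, Multiset.card_add,
    card_filter_map_sq, Multiset.filter_eq_nil.2, Multiset.card_zero, add_zero]
  intro a ha
  rwa [Multiset.eq_of_mem_replicate ha]

open Classical in
lemma card_filter_roots_pencilDet_of_mem (hp : p.Monic) (hk : halfDeg p = k + 1)
    (hS : IsUnit S) (hdiag : S⁻¹ * blockA p k * S = !![α, 0; 0, β]) {D : Set ℂ} (hD : 0 ∈ D) :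
    ((pencilDet k α β (blockT p S) 1).roots.filter (· ∈ D)).card =
      sqZeroCount p D + padding p := by
  rw [roots_pencilDet_blockT_eq_add hp hk hS hdiag, Multiset.filter_add, Multiset.card_add,
    card_filter_map_sq, Multiset.filter_eq_self.2, Multiset.card_replicate]
  intro a ha
  rwa [Multiset.eq_of_mem_replicate ha]

end Padded

/-! ### Counting zeros in the central disc and in the outer discs -/

section Localization

variable {k : ℕ} {α β γ δ : ℂ} {T : ℕ → Matrix (Fin 2) (Fin 2) ℂ} {N : Seminorm ℂ (Fin 2 → ℂ)}
  {g x₁ x₂ : ℝ}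

lemma notMem_Ioo_of_eval_pencilDet_eq_zero (hN : IsAbsoluteNorm N) (hαβ : ‖α‖ ≤ ‖β‖)
    (h : IsPosRootPair (radialGap (fun j => subNorm N (T j)) k ‖α‖) x₁ x₂) {t w : ℂ}
    (ht : ‖t‖ ≤ 1) (hw : (pencilDet k α β T t).eval w = 0) : ‖w‖ ∉ Set.Ioo x₁ x₂ := by
  intro hmem
  have hw0 : w ≠ 0 := norm_pos_iff.1 (h.left_mem.1.trans hmem.1)
  have hneg := h.neg_of_mem_Ioo (convexOn_radialGap (fun j => subNorm_nonneg N (T j)) _) hmem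
  unfold radialGap at hneg
  have ha := norm_sub_norm_le α w
  have hb := norm_sub_norm_le β w
  rw [norm_sub_rev] at ha hb
  rcases norm_sub_le_or_of_eval_pencilDet_eq_zero hN ht hw0 hw with h1 | h1 <;> linarith

lemma mem_closedBall_or_of_le_norm (hN : IsAbsoluteNorm N) {t w : ℂ} {x : ℝ} (hx : 0 < x)
    (ht : ‖t‖ ≤ 1) (hw : (pencilDet k α β T t).eval w = 0) (hxw : x ≤ ‖w‖) :
    ‖w - α‖ ≤ inversePowerSum (fun j => subNorm N (T j)) k x ∨
      ‖w - β‖ ≤ inversePowerSum (fun j => subNorm N (T j)) k x :=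
  have hmono := inversePowerSum_anti (k := k) (fun j => subNorm_nonneg N (T j)) hx hxw
  (norm_sub_le_or_of_eval_pencilDet_eq_zero hN ht (norm_pos_iff.1 (hx.trans_le hxw)) hw).imp
    (fun h => h.trans hmono) fun h => h.trans hmono

-- The annulus stays free of zeros for all `|t| ≤ 1`, so the count on a circle inside it can be read
-- off at `t = 0`. There only the `2k` zeros at the origin count, as `|β| ≥ |α| ≥ x₂`.
open Metric in
open Classical in
lemma card_roots_pencilDet_norm_le (hN : IsAbsoluteNorm N) (hαβ : ‖α‖ ≤ ‖β‖)
    (h : IsPosRootPair (radialGap (fun j => subNorm N (T j)) k ‖α‖) x₁ x₂) :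
    ((pencilDet k α β T 1).roots.filter (· ∈ closedBall 0 x₁)).card = 2 * k := by
  obtain ⟨h1, -⟩ := h.left_mem
  obtain ⟨h2, f2⟩ := h.right_mem
  have hτ := inversePowerSum_nonneg (k := k) (fun j => subNorm_nonneg N (T j)) h2
  unfold radialGap at f2
  obtain ⟨r, hr1, hr2⟩ := exists_between h.1
  have hcard := card_roots_pencilDet_ball_eq (k := k) (α := α) (β := β) (T := T) (z := 0)
    (h1.trans hr1) fun t ht w hw hw0 =>
      notMem_Ioo_of_eval_pencilDet_eq_zero hN hαβ h ht hw0 (by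
        rw [mem_sphere_zero_iff_norm.1 hw]
        exact ⟨hr1, hr2⟩)
  have hα : α ∉ ball (0 : ℂ) r := by
    rw [mem_ball_zero_iff]
    linarith
  have hβ : β ∉ ball (0 : ℂ) r := by
    rw [mem_ball_zero_iff]
    linarith
  have h0 : (Multiset.replicate (2 * k) (0 : ℂ)).filter (· ∈ ball (0 : ℂ) r) =
      Multiset.replicate (2 * k) 0 :=
    Multiset.filter_eq_self.2 fun a ha => by
      rw [Multiset.eq_of_mem_replicate ha]
      exact mem_ball_self (h1.trans hr1)
  rw [Multiset.filter_add, Multiset.filter_add, Multiset.filter_singleton,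
    Multiset.filter_singleton, if_neg hα, if_neg hβ, h0] at hcard
  simp only [Multiset.empty_eq_zero, add_zero, Multiset.card_replicate] at hcard
  rw [← hcard]
  congr 1
  refine Multiset.filter_congr fun w hw => ?_
  rw [mem_closedBall_zero_iff, mem_ball_zero_iff]
  refine ⟨fun hle => hle.trans_lt hr1, fun hlt => not_lt.1 fun hlt' => ?_⟩
  exact notMem_Ioo_of_eval_pencilDet_eq_zero hN hαβ h norm_one.le (isRoot_of_mem_roots hw)
    ⟨hlt', hlt.trans hr2⟩

open Metric in
open Classical in
/-- If the discs are disjoint, each of them contains one zero. -/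
lemma card_roots_pencilDet_closedBall (hN : IsAbsoluteNorm N)
    (hγ : γ = α ∧ δ = β ∨ γ = β ∧ δ = α) (hg : g ≤ ‖γ‖)
    (h : IsPosRootPair (radialGap (fun j => subNorm N (T j)) k g) x₁ x₂)
    (hsep : 2 * inversePowerSum (fun j => subNorm N (T j)) k x₂ < ‖γ - δ‖) :
    ((pencilDet k α β T 1).roots.filter
      (· ∈ closedBall γ (inversePowerSum (fun j => subNorm N (T j)) k x₂))).card = 1 := by
  have hc : ∀ j, 0 ≤ subNorm N (T j) := fun j => subNorm_nonneg N (T j)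
  obtain ⟨h1, -⟩ := h.left_mem
  obtain ⟨h2, f2⟩ := h.right_mem
  have hneg : ∀ x ∈ Set.Ioo x₁ x₂,
      x - g + inversePowerSum (fun j => subNorm N (T j)) k x < 0 := fun x hx =>
    h.neg_of_mem_Ioo (convexOn_radialGap hc _) hx
  have hnear : ∀ t w : ℂ, ‖t‖ ≤ 1 → w ≠ 0 → (pencilDet k α β T t).eval w = 0 →
      ‖w - γ‖ ≤ inversePowerSum (fun j => subNorm N (T j)) k ‖w‖ ∨
      ‖w - δ‖ ≤ inversePowerSum (fun j => subNorm N (T j)) k ‖w‖ := by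
    intro t w ht hw hw0
    have := norm_sub_le_or_of_eval_pencilDet_eq_zero hN ht hw hw0
    rcases hγ with ⟨rfl, rfl⟩ | ⟨rfl, rfl⟩
    · exact this
    · exact this.symm
  have hanti : ∀ x y, 0 < x → x ≤ y →
      inversePowerSum (fun j => subNorm N (T j)) k y ≤
        inversePowerSum (fun j => subNorm N (T j)) k x := fun x y hx hxy =>
    inversePowerSum_anti hc hx hxy
  have hnn : ∀ x, 0 < x → 0 ≤ inversePowerSum (fun j => subNorm N (T j)) k x := fun x hx =>
    inversePowerSum_nonneg hc hx
  unfold radialGap at f2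
  set τ := inversePowerSum (fun j => subNorm N (T j)) k
  -- The disc radius is `τ x₂ = g - x₂`; taking `y` just below `x₂` gives a slightly larger circle
  -- of radius `g - y`. On it `|w| ≥ y`, hence `τ |w| ≤ τ y < g - y`, and `y > g - |γ - δ| / 2`
  -- keeps it farther than `g - y` from `δ`.
  obtain ⟨y, hy1, hy2⟩ := exists_between
    (max_lt h.1 (by linarith : g - ‖γ - δ‖ / 2 < x₂))
  obtain ⟨hy1, hysep⟩ := max_lt_iff.1 hy1
  have hy0 : 0 < y := h1.trans hy1
  have hyτ := hneg y ⟨hy1, hy2⟩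
  have hτy := hnn y hy0
  have hlow : ∀ w, ‖γ‖ - ‖w - γ‖ ≤ ‖w‖ := fun w => by
    have := norm_sub_norm_le γ w
    rw [norm_sub_rev] at this
    linarith
  have htri : ∀ w, ‖γ - δ‖ ≤ ‖w - γ‖ + ‖w - δ‖ := fun w => by
    have := norm_sub_le_norm_sub_add_norm_sub γ w δ
    rwa [norm_sub_rev γ w] at this
  have hcard := card_roots_pencilDet_ball_eq (k := k) (α := α) (β := β) (T := T) (z := γ)
    (r := g - y) (by linarith) fun t ht w hw hw0 => by
      rw [mem_sphere, dist_eq_norm] at hw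
      have hwy : y ≤ ‖w‖ := by linarith [hlow w]
      have := hanti y ‖w‖ hy0 hwy
      have := htri w
      rcases hnear t w ht (norm_pos_iff.1 (hy0.trans_le hwy)) hw0 with h | h <;> linarith
  have h0 : (Multiset.replicate (2 * k) (0 : ℂ)).filter (· ∈ ball γ (g - y)) = 0 :=
    Multiset.filter_eq_nil.2 fun a ha => by
      rw [Multiset.eq_of_mem_replicate ha, mem_ball, dist_eq_norm, zero_sub, norm_neg]
      linarith
  have hγm : γ ∈ ball γ (g - y) := mem_ball_self (by linarith)
  have hδm : δ ∉ ball γ (g - y) := by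
    rw [mem_ball, dist_eq_norm, norm_sub_rev]
    linarith
  have hone : ((Multiset.replicate (2 * k) (0 : ℂ) + {α} + {β}).filter
      (· ∈ ball γ (g - y))).card = 1 := by
    rw [Multiset.filter_add, Multiset.filter_add, h0, Multiset.filter_singleton,
      Multiset.filter_singleton]
    rcases hγ with ⟨rfl, rfl⟩ | ⟨rfl, rfl⟩
    · rw [if_pos hγm, if_neg hδm]
      rfl
    · rw [if_pos hγm, if_neg hδm]
      rfl
  rw [← hone, ← hcard]
  congr 1
  refine Multiset.filter_congr fun w hw => ?_
  have hw0 : (pencilDet k α β T 1).eval w = 0 := isRoot_of_mem_roots hw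
  rw [mem_closedBall, mem_ball, dist_eq_norm]
  refine ⟨fun hle => by linarith, fun hlt => ?_⟩
  have hwy : y < ‖w‖ := by linarith [hlow w]
  rcases hnear 1 w norm_one.le (norm_pos_iff.1 (hy0.trans hwy)) hw0 with hle | hle
  -- No zero lies between the two radii: for `y < |w| < x₂` the negative gap contradicts `|w - γ| ≥
  -- g - |w|`.
  · rcases lt_or_ge ‖w‖ x₂ with hlt' | hge
    · linarith [hneg ‖w‖ ⟨hy1.trans hwy, hlt'⟩, hlow w]
    · exact hle.trans (hanti _ _ h2 hge)
  · linarith [hanti y ‖w‖ hy0 hwy.le, htri w]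

end Localization

/-! ### Translation between `Ω`, `τ` and the convex gap function -/

section Omega

variable {p : ℂ[X]} {S : Matrix (Fin 2) (Fin 2) ℂ} {N : Seminorm ℂ (Fin 2 → ℂ)} {k : ℕ}

lemma tau_eq_inversePowerSum (hk : halfDeg p = k + 1) (x : ℝ) :
    tau p S N x = inversePowerSum (fun j => subNorm N (blockT p S j)) k x := by
  rw [tau, hk]
  rfl

/-- `Omega` is `x ^ k` times the gap, so the positive zeros agree; only the gap is known to be
convex. -/
lemma isPosRootPair_Omega_iff (hk : halfDeg p = k + 1) (γ : ℂ) (a b : ℝ) :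
    IsPosRootPair (Omega p S N γ) a b ↔
      IsPosRootPair (radialGap (fun j => subNorm N (blockT p S j)) k ‖γ‖) a b := by
  have key : ∀ x, 0 < x → (Omega p S N γ x = 0 ↔
      radialGap (fun j => subNorm N (blockT p S j)) k ‖γ‖ x = 0) := by
    intro x hx
    have : Omega p S N γ x =
        x ^ k * radialGap (fun j => subNorm N (blockT p S j)) k ‖γ‖ x := by
      rw [mul_radialGap _ hx, Omega, hk]
      rfl
    rw [this, mul_eq_zero, or_iff_right (pow_ne_zero k hx.ne')]
  exact ⟨fun h => h.congr key, fun h => h.congr fun x hx => (key x hx).symm⟩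

open Classical in
lemma zeroCount_closedBall_sqrt (p : ℂ[X]) {x : ℝ} (hx : 0 ≤ x) :
    zeroCount p (Metric.closedBall 0 (√x)) = sqZeroCount p (Metric.closedBall 0 x) := by
  unfold zeroCount sqZeroCount
  refine congrArg Multiset.card (Multiset.filter_congr fun z _ => ?_)
  rw [mem_closedBall_zero_iff, mem_closedBall_zero_iff, norm_pow,
    Real.le_sqrt (norm_nonneg z) hx]

end Omega

end SquaredCompanion
end

open SquaredCompanion in
theorem theorem4p2 (p : Polynomial ℂ) (hp : p.Monic) (hdeg : 3 ≤ p.natDegree)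
    (N : Seminorm ℂ (Fin 2 → ℂ)) (hN : IsAbsoluteNorm N)
    (S : Matrix (Fin 2) (Fin 2) ℂ) (hS : IsUnit S) (α β : ℂ)
    (hdiag : S⁻¹ * blockA p (halfDeg p - 1) * S = !![α, 0; 0, β]) (hαβ : ‖α‖ ≤ ‖β‖) :
    -- part (a)
    (∀ x₁ x₂ : ℝ, IsPosRootPair (Omega p S N α) x₁ x₂ →
      (rootInterval (Omega p S N β)).Nonempty ∧
      rootInterval (Omega p S N α) ⊆ rootInterval (Omega p S N β) ∧
      zeroCount p (Metric.closedBall 0 (√x₁)) = p.natDegree - 2 ∧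
      sqZeroCount p (Metric.closedBall α (tau p S N x₂) ∪ Metric.closedBall β (tau p S N x₂)) = 2 ∧
      (∀ z : ℂ, p.IsRoot z → z ∉ Metric.closedBall 0 (√x₁) →
        z ^ 2 ∈ Metric.closedBall α (tau p S N x₂) ∪ Metric.closedBall β (tau p S N x₂)) ∧
      (∀ z : ℂ, p.IsRoot z → ¬ (√x₁ < ‖z‖ ∧ ‖z‖ < √(‖α‖ - tau p S N x₂))) ∧
      (2 * tau p S N x₂ < ‖α - β‖ →
        sqZeroCount p (Metric.closedBall α (tau p S N x₂)) = 1 ∧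
        sqZeroCount p (Metric.closedBall β (tau p S N x₂)) = 1)) ∧
    -- part (b)
    (∀ y₁ y₂ : ℝ, rootInterval (Omega p S N α) = ∅ → IsPosRootPair (Omega p S N β) y₁ y₂ →
      2 * tau p S N y₂ < ‖α - β‖ →
        sqZeroCount p (Metric.closedBall β (tau p S N y₂)) = 1 ∧
        ∀ z : ℂ, p.IsRoot z → z ^ 2 ∉ Metric.closedBall β (tau p S N y₂) →
          z ^ 2 ∈ Metric.closedBall 0 y₂ ∪ Metric.closedBall α (tau p S N y₂)) := by
  classical
  obtain ⟨k, hk⟩ : ∃ k, halfDeg p = k + 1 :=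
    ⟨halfDeg p - 1, by unfold halfDeg; omega⟩
  rw [hk, Nat.add_sub_cancel] at hdiag
  have hc : ∀ j, 0 ≤ subNorm N (blockT p S j) := fun j => subNorm_nonneg N _
  have hroot : ∀ z, p.IsRoot z → (pencilDet k α β (blockT p S) 1).eval (z ^ 2) = 0 :=
    fun z hz => isRoot_of_mem_roots (sq_mem_roots_pencilDet hp hk hS hdiag hz)
  simp only [tau_eq_inversePowerSum hk]
  have hball : ∀ (γ w : ℂ) (x : ℝ), w ∈ Metric.closedBall γ x ↔ ‖w - γ‖ ≤ x :=
    fun γ w x => by rw [Metric.mem_closedBall, dist_eq_norm]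
  constructor
  · intro x₁ x₂ h
    have hsub : ∀ a b, IsPosRootPair (Omega p S N α) a b →
        ∃ c d, c ≤ a ∧ b ≤ d ∧ IsPosRootPair (Omega p S N β) c d := by
      intro a b hab
      obtain ⟨c, d, hca, hbd, hcd⟩ :=
        exists_isPosRootPair_radialGap hc hαβ ((isPosRootPair_Omega_iff hk α a b).1 hab)
      exact ⟨c, d, hca, hbd, (isPosRootPair_Omega_iff hk β c d).2 hcd⟩
    have hint : rootInterval (Omega p S N α) ⊆ rootInterval (Omega p S N β) := by
      rintro x ⟨a, b, hab, hx⟩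
      obtain ⟨c, d, hca, hbd, hcd⟩ := hsub a b hab
      exact ⟨c, d, hcd, hca.trans hx.1, hx.2.trans hbd⟩
    have hne : (rootInterval (Omega p S N β)).Nonempty :=
      ⟨x₁, hint ⟨x₁, x₂, h, Set.left_mem_Icc.2 h.1.le⟩⟩
    rw [isPosRootPair_Omega_iff hk] at h
    obtain ⟨h1, -⟩ := h.left_mem
    obtain ⟨h2, f2⟩ := h.right_mem
    unfold radialGap at f2
    have hcount := card_roots_pencilDet_norm_le hN hαβ h
    have hunion : ∀ w, (pencilDet k α β (blockT p S) 1).eval w = 0 → x₁ < ‖w‖ →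
        w ∈ Metric.closedBall α (inversePowerSum (fun j => subNorm N (blockT p S j)) k x₂) ∪
          Metric.closedBall β (inversePowerSum (fun j => subNorm N (blockT p S j)) k x₂) := by
      intro w hw hlt
      have hge : x₂ ≤ ‖w‖ := not_lt.1 fun hlt' =>
        notMem_Ioo_of_eval_pencilDet_eq_zero hN hαβ h norm_one.le hw ⟨hlt, hlt'⟩
      rw [Set.mem_union, hball, hball]
      exact mem_closedBall_or_of_le_norm hN h2 norm_one.le hw hge
    have hfar : ∀ w,
        w ∈ Metric.closedBall α (inversePowerSum (fun j => subNorm N (blockT p S j)) k x₂) ∪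
          Metric.closedBall β (inversePowerSum (fun j => subNorm N (blockT p S j)) k x₂) →
        x₂ ≤ ‖w‖ := by
      intro w hw
      rw [Set.mem_union, hball, hball] at hw
      have ha := norm_sub_norm_le α w
      have hb := norm_sub_norm_le β w
      rw [norm_sub_rev] at ha hb
      rcases hw with hw | hw <;> linarith
    have h0mem : (0 : ℂ) ∉
        Metric.closedBall α (inversePowerSum (fun j => subNorm N (blockT p S j)) k x₂) ∪
          Metric.closedBall β (inversePowerSum (fun j => subNorm N (blockT p S j)) k x₂) := by
      intro h0
      have := hfar 0 h0
      rw [norm_zero] at this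
      linarith
    have hdegp := natDegree_add_padding hk
    -- Of the `2(k + 1)` zeros, `2k` lie in the central disc; a set avoiding `0` that captures the
    -- rest loses nothing to the padding zero.
    have hcompl : ∀ D : Set ℂ, 0 ∉ D →
        (∀ w, (pencilDet k α β (blockT p S) 1).eval w = 0 → (w ∈ D ↔ x₁ < ‖w‖)) →
        sqZeroCount p D = 2 := by
      intro D hD hiff
      have htotal : Multiset.card (pencilDet k α β (blockT p S) 1).roots = 2 * (k + 1) := by
        rw [roots_pencilDet_blockT hp hk hS hdiag, Multiset.card_map, card_roots_padded hp hk]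
      have hsplit := congrArg Multiset.card (Multiset.filter_add_not
        (· ∈ Metric.closedBall (0 : ℂ) x₁) (pencilDet k α β (blockT p S) 1).roots)
      rw [Multiset.card_add, hcount, htotal] at hsplit
      rw [← card_filter_roots_pencilDet_of_notMem hp hk hS hdiag hD,
        Multiset.filter_congr (q := fun w => w ∉ Metric.closedBall (0 : ℂ) x₁) fun w hw => ?_]
      · omega
      · rw [mem_closedBall_zero_iff, not_le]
        exact hiff w (isRoot_of_mem_roots hw)
    refine ⟨hne, hint, ?_, ?_, ?_, ?_, ?_⟩
    · rw [zeroCount_closedBall_sqrt p h1.le]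
      have := card_filter_roots_pencilDet_of_mem hp hk hS hdiag
        (D := Metric.closedBall 0 x₁) (Metric.mem_closedBall_self h1.le)
      -- The central disc contains the padding zero: `2k` less the padding equals `ℓ - 2`.
      omega
    · exact hcompl _ h0mem fun w hw => ⟨fun hw' => h.1.trans_le (hfar w hw'), hunion w hw⟩
    · intro z hz hz'
      refine hunion _ (hroot z hz) ?_
      rw [mem_closedBall_zero_iff, Real.le_sqrt (norm_nonneg z) h1.le, not_le] at hz'
      rwa [norm_pow]
    · rintro z hz ⟨hz1, hz2⟩
      rw [Real.sqrt_lt' (lt_of_le_of_lt (Real.sqrt_nonneg _) hz1)] at hz1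
      rw [Real.lt_sqrt (norm_nonneg z)] at hz2
      refine notMem_Ioo_of_eval_pencilDet_eq_zero hN hαβ h norm_one.le (hroot z hz) ?_
      rw [norm_pow]
      -- Since `|α| - τ(x₂) = x₂`, the claimed gap is exactly the zero-free annulus.
      exact ⟨hz1, by linarith⟩
    · intro hsep
      constructor
      · rw [← card_filter_roots_pencilDet_of_notMem hp hk hS hdiag fun h0 => h0mem (Or.inl h0)]
        exact card_roots_pencilDet_closedBall hN (Or.inl ⟨rfl, rfl⟩) le_rfl h hsep
      · rw [← card_filter_roots_pencilDet_of_notMem hp hk hS hdiag fun h0 => h0mem (Or.inr h0)]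
        rw [norm_sub_rev] at hsep
        exact card_roots_pencilDet_closedBall hN (Or.inr ⟨rfl, rfl⟩) hαβ h hsep
  · intro y₁ y₂ _ h hsep
    rw [isPosRootPair_Omega_iff hk] at h
    obtain ⟨h2, f2⟩ := h.right_mem
    unfold radialGap at f2
    constructor
    · rw [← card_filter_roots_pencilDet_of_notMem hp hk hS hdiag fun h0 => ?_]
      · rw [norm_sub_rev] at hsep
        exact card_roots_pencilDet_closedBall hN (Or.inr ⟨rfl, rfl⟩) le_rfl h hsep
      -- The origin is outside the disc because `|β| - τ(y₂) = y₂ > 0`.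
      · rw [hball, zero_sub, norm_neg] at h0
        linarith
    · intro z hz hz'
      rw [hball] at hz'
      rw [Set.mem_union, hball, hball, sub_zero]
      rcases le_or_gt ‖z ^ 2‖ y₂ with hle | hlt
      · exact Or.inl hle
      · exact Or.inr ((mem_closedBall_or_of_le_norm hN h2 norm_one.le (hroot z hz)
          hlt.le).resolve_right hz')
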